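/- Let $A$ and $B$ be $n\times n$ complex positive semidefinite (Hermitian) matrices. Denote by $\|\cdot\|$ the spectral norm (the operator norm induced by the Euclidean norm on $\mathbb{C}^n$, i.e. the largest singular value), by $s_1(X)\ge s_2(X)\ge\cdots\ge s_n(X)$ the singular values of an $n\times n$ matrix $X$ in nonincreasing order, and by $\lambda_1(H)\ge\lambda_2(H)\ge\cdots\ge\lambda_n(H)$ the eigenvalues of an $n\times n$ Hermitian matrix $H$ in nonincreasing order, in both cases counted with multiplicity. Then $$2\,s_j(AB)\le \lambda_j\bigl(\|B\|\,A+\|A\|\,B\bigr),\qquad j=1,\ldots,n.$$ -/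

import Mathlib

open scoped Matrix.Norms.L2Operator ComplexOrder

/-- The `j`-th largest singular value of a complex `n × n` matrix, counted with multiplicity
(zero-indexed: `j = 0` gives the largest one). -/
noncomputable def Matrix.sv {n : ℕ} (A : Matrix (Fin n) (Fin n) ℂ) (j : Fin n) : ℝ :=
  (Matrix.toEuclideanLin A).singularValues j

/-- The `j`-th largest eigenvalue of a complex Hermitian `n × n` matrix, counted with multiplicity
(zero-indexed: `j = 0` gives the largest one). -/
noncomputable def Matrix.eig {n : ℕ} (A : Matrix (Fin n) (Fin n) ℂ)
    (hA : A.IsHermitian) (j : Fin n) : ℝ :=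
  hA.eigenvalues₀ (Fin.cast (Fintype.card_fin n).symm j)

/-- Real linear combinations of positive semidefinite matrices are Hermitian. -/
theorem Matrix.PosSemidef.isHermitian_smul_add_smul {n : ℕ} {A B : Matrix (Fin n) (Fin n) ℂ}
    (hA : A.PosSemidef) (hB : B.PosSemidef) (a b : ℝ) : (a • A + b • B).IsHermitian := by
  unfold Matrix.IsHermitian
  rw [Matrix.conjTranspose_add, Matrix.conjTranspose_smul, Matrix.conjTranspose_smul,
    hA.isHermitian.eq, hB.isHermitian.eq, star_trivial, star_trivial]

/-! Write a = ‖A‖, b = ‖B‖, P = bA + aB, s = s_j(AB) > 0. By Courant-Fischer it suffices that ⟨Pz,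
z⟩ ≥ 2s‖z‖² on a space of dimension one more than the zero-based index j. Singular vectors AB vᵢ =
sᵢuᵢ supply it: for u = ∑ cᵢuᵢ and v = ∑ cᵢvᵢ take z = bAu + aBv. Then Re⟨Au, Bv⟩ = ∑ sᵢ|cᵢ|² ≥
s|c|² gives ‖z‖² ≥ 4abs|c|². Positivity of A at 2su - z and of B at 2sv - z, with A ≤ a and B ≤ b,
gives ⟨Pz, z⟩ ≥ 4s‖z‖² - 8abs²|c|² ≥ 2s‖z‖². -/

open Module InnerProductSpace in
/-- On the orthogonal complement of the first `j` eigenvectors, the quadratic form of a symmetric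
operator is bounded by its `j`-th eigenvalue. -/
theorem LinearMap.IsSymmetric.re_inner_apply_self_le_eigenvalues_mul {𝕜 E : Type*} [RCLike 𝕜]
    [NormedAddCommGroup E] [InnerProductSpace 𝕜 E] [FiniteDimensional 𝕜 E] {T : E →ₗ[𝕜] E}
    (hT : T.IsSymmetric) {n : ℕ} (hn : finrank 𝕜 E = n) (j : Fin n) {x : E}
    (hx : ∀ i < j, inner 𝕜 (hT.eigenvectorBasis hn i) x = 0) :
    RCLike.re (inner 𝕜 (T x) x) ≤ hT.eigenvalues hn j * ‖x‖ ^ 2 := by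
  set e := hT.eigenvectorBasis hn
  have hinner : inner 𝕜 (T x) x =
      ∑ i, ((hT.eigenvalues hn i * ‖inner 𝕜 (e i) x‖ ^ 2 : ℝ) : 𝕜) := by
    rw [← e.sum_inner_mul_inner]
    refine Finset.sum_congr rfl fun i _ ↦ ?_
    rw [hT x (e i), hT.apply_eigenvectorBasis, inner_smul_right, mul_assoc,
      ← inner_conj_symm x, RCLike.conj_mul]
    push_cast
    rfl
  rw [hinner, ← RCLike.ofReal_sum, RCLike.ofReal_re, ← e.sum_sq_norm_inner_right x, Finset.mul_sum]
  refine Finset.sum_le_sum fun i _ ↦ ?_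
  rcases lt_or_ge i j with h | h
  · simp [e, hx i h]
  · exact mul_le_mul_of_nonneg_right (hT.eigenvalues_antitone hn h) (sq_nonneg _)

open Module InnerProductSpace in
/-- The lower bound in the Courant-Fischer principle, for a subspace parametrized by an injective
linear map. -/
theorem LinearMap.IsSymmetric.le_eigenvalues_of_lt_finrank {𝕜 E F : Type*} [RCLike 𝕜]
    [NormedAddCommGroup E] [InnerProductSpace 𝕜 E] [FiniteDimensional 𝕜 E]
    [AddCommGroup F] [Module 𝕜 F] [FiniteDimensional 𝕜 F] {T : E →ₗ[𝕜] E}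
    (hT : T.IsSymmetric) {n : ℕ} (hn : finrank 𝕜 E = n) (j : Fin n) (L : F →ₗ[𝕜] E)
    (hF : (j : ℕ) < finrank 𝕜 F) (hL : ∀ c ≠ 0, L c ≠ 0) {t : ℝ}
    (ht : ∀ c, t * ‖L c‖ ^ 2 ≤ RCLike.re (inner 𝕜 (T (L c)) (L c))) :
    t ≤ hT.eigenvalues hn j := by
  let f : F →ₗ[𝕜] (Fin j → 𝕜) := LinearMap.pi fun i ↦
    (innerₛₗ 𝕜 (hT.eigenvectorBasis hn (i.castLE j.isLt.le))) ∘ₗ L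
  -- Only `j` orthogonality conditions are imposed on more than `j` dimensions.
  have hf : LinearMap.ker f ≠ ⊥ := LinearMap.ker_ne_bot_of_finrank_lt (by simpa using hF)
  obtain ⟨c, hc, hc0⟩ := (Submodule.ne_bot_iff _).1 hf
  have horth : ∀ i < j, inner 𝕜 (hT.eigenvectorBasis hn i) (L c) = 0 := fun i hi ↦
    congrFun (LinearMap.mem_ker.1 hc) ⟨i, hi⟩
  have hpos : 0 < ‖L c‖ ^ 2 := by
    have := norm_pos_iff.2 (hL c hc0)
    positivity
  exact le_of_mul_le_mul_right
    ((ht c).trans (hT.re_inner_apply_self_le_eigenvalues_mul hn j horth)) hpos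

theorem Orthonormal.norm_sq_linearCombination {𝕜 E ι : Type*} [RCLike 𝕜] [Fintype ι]
    [NormedAddCommGroup E] [InnerProductSpace 𝕜 E] {w : ι → E} (hw : Orthonormal 𝕜 w)
    (c : ι → 𝕜) : ‖Fintype.linearCombination 𝕜 w c‖ ^ 2 = ∑ i, ‖c i‖ ^ 2 := by
  rw [← inner_self_eq_norm_sq (𝕜 := 𝕜), Fintype.linearCombination_apply, hw.inner_sum, map_sum]
  refine Finset.sum_congr rfl fun i _ ↦ ?_
  rw [RCLike.conj_mul, ← RCLike.ofReal_pow, RCLike.ofReal_re]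

open Module InnerProductSpace in
/-- Left and right singular vectors: if the `j`-th singular value of `M` is positive, then there
are orthonormal families `u`, `v` of length `j + 1` with `M (v i) = sᵢ • u i`. -/
theorem LinearMap.exists_orthonormal_apply_eq_singularValues_smul {𝕜 E F : Type*} [RCLike 𝕜]
    [NormedAddCommGroup E] [InnerProductSpace 𝕜 E] [FiniteDimensional 𝕜 E]
    [NormedAddCommGroup F] [InnerProductSpace 𝕜 F] [FiniteDimensional 𝕜 F] (M : E →ₗ[𝕜] F)
    {j : ℕ} (hj : 0 < M.singularValues j) :
    ∃ (u : Fin (j + 1) → F) (v : Fin (j + 1) → E), Orthonormal 𝕜 u ∧ Orthonormal 𝕜 v ∧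
      ∀ i, M (v i) = (M.singularValues i : 𝕜) • u i := by
  have hjn : j < finrank 𝕜 E := by
    by_contra! h
    exact hj.ne' (M.singularValues_of_finrank_le h)
  set hS := M.isSymmetric_adjoint_comp_self
  have hpos (i : Fin (j + 1)) : 0 < M.singularValues i :=
    hj.trans_le (M.singularValues_antitone (Nat.lt_succ_iff.1 i.isLt))
  have hne (i : Fin (j + 1)) : (M.singularValues i : 𝕜) ≠ 0 :=
    RCLike.ofReal_ne_zero.2 (hpos i).ne'
  let v : Fin (j + 1) → E := fun i ↦ hS.eigenvectorBasis rfl (i.castLE hjn)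
  have hv : Orthonormal 𝕜 v :=
    (hS.eigenvectorBasis rfl).orthonormal.comp _ (Fin.castLE_injective hjn)
  have hMv (i k : Fin (j + 1)) : inner 𝕜 (M (v i)) (M (v k)) =
      (M.singularValues k : 𝕜) ^ 2 * inner 𝕜 (v i) (v k) := by
    rw [← LinearMap.adjoint_inner_right, ← LinearMap.comp_apply, hS.apply_eigenvectorBasis,
      ← M.sq_singularValues_fin, inner_smul_right]
    simp [v]
  refine ⟨fun i ↦ (M.singularValues i : 𝕜)⁻¹ • M (v i), v, ?_, hv, fun i ↦ ?_⟩
  · rw [orthonormal_iff_ite] at hv ⊢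
    intro i k
    rw [inner_smul_left, inner_smul_right, hMv, hv i k, map_inv₀, RCLike.conj_ofReal]
    split_ifs with h
    · subst h
      field_simp [hne i]
    · simp
  · rw [smul_inv_smul₀ (hne i)]

open Module InnerProductSpace in
/-- The arithmetic-geometric mean inequality for singular values of a product of two positive
operators whose quadratic forms are bounded by `a` and `b`. -/
theorem LinearMap.IsPositive.two_mul_singularValues_comp_le {𝕜 E : Type*} [RCLike 𝕜]
    [NormedAddCommGroup E] [InnerProductSpace 𝕜 E] [FiniteDimensional 𝕜 E] {S T P : E →ₗ[𝕜] E}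
    (hS : S.IsPositive) (hT : T.IsPositive) (hP : P.IsSymmetric) {a b : ℝ} (ha : 0 < a)
    (hb : 0 < b) (hSa : ∀ x, RCLike.re (inner 𝕜 (S x) x) ≤ a * ‖x‖ ^ 2)
    (hTb : ∀ x, RCLike.re (inner 𝕜 (T x) x) ≤ b * ‖x‖ ^ 2)
    (hPST : ∀ x, P x = (b : 𝕜) • S x + (a : 𝕜) • T x)
    {n : ℕ} (hn : finrank 𝕜 E = n) (j : Fin n)
    (hs : 0 < (S ∘ₗ T).singularValues j) :
    2 * (S ∘ₗ T).singularValues j ≤ hP.eigenvalues hn j := by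
  set s := (S ∘ₗ T).singularValues j
  have hPre (x : E) : RCLike.re (inner 𝕜 (P x) x) =
      b * RCLike.re (inner 𝕜 (S x) x) + a * RCLike.re (inner 𝕜 (T x) x) := by
    simp [hPST, inner_add_left, inner_smul_left]
  obtain ⟨u, v, hu, hv, huv⟩ := (S ∘ₗ T).exists_orthonormal_apply_eq_singularValues_smul hs
  let U := Fintype.linearCombination 𝕜 u
  let V := Fintype.linearCombination 𝕜 v
  let Z := (b : 𝕜) • S ∘ₗ U + (a : 𝕜) • T ∘ₗ V
  have hU (c) : ‖U c‖ ^ 2 = ∑ i, ‖c i‖ ^ 2 := hu.norm_sq_linearCombination c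
  have hV (c) : ‖V c‖ ^ 2 = ∑ i, ‖c i‖ ^ 2 := hv.norm_sq_linearCombination c
  have hZ (c) : Z c = (b : 𝕜) • S (U c) + (a : 𝕜) • T (V c) := rfl
  have hUV (c) : s * ∑ i, ‖c i‖ ^ 2 ≤ RCLike.re (inner 𝕜 (S (U c)) (T (V c))) := by
    have hMV : S (T (V c)) = ∑ i, (c i * ((S ∘ₗ T).singularValues i : 𝕜)) • u i := by
      rw [← LinearMap.comp_apply]
      simp only [V, Fintype.linearCombination_apply, map_sum, map_smul, huv, smul_smul]
    rw [hS.1, hMV]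
    simp only [U, Fintype.linearCombination_apply]
    rw [hu.inner_sum, map_sum, Finset.mul_sum]
    refine Finset.sum_le_sum fun i _ ↦ ?_
    rw [← mul_assoc, RCLike.conj_mul, ← RCLike.ofReal_pow, ← RCLike.ofReal_mul,
      RCLike.ofReal_re, mul_comm]
    exact mul_le_mul_of_nonneg_left
      ((S ∘ₗ T).singularValues_antitone (Nat.lt_succ_iff.1 i.isLt)) (sq_nonneg _)
  -- From ‖p + q‖² = ‖p - q‖² + 4 Re⟨p, q⟩ with p = bSu, q = aTv.
  have hZge (c) : 4 * a * b * s * ∑ i, ‖c i‖ ^ 2 ≤ ‖Z c‖ ^ 2 := by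
    have h1 := norm_add_sq (𝕜 := 𝕜) ((b : 𝕜) • S (U c)) ((a : 𝕜) • T (V c))
    have h2 := norm_sub_sq (𝕜 := 𝕜) ((b : 𝕜) • S (U c)) ((a : 𝕜) • T (V c))
    have h3 : RCLike.re (inner 𝕜 ((b : 𝕜) • S (U c)) ((a : 𝕜) • T (V c))) =
        a * b * RCLike.re (inner 𝕜 (S (U c)) (T (V c))) := by
      rw [inner_smul_left, inner_smul_right, RCLike.conj_ofReal, RCLike.re_ofReal_mul,
        RCLike.re_ofReal_mul]
      ring
    have h4 := mul_le_mul_of_nonneg_left (hUV c) (mul_pos ha hb).le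
    rw [← hZ] at h1
    linarith [sq_nonneg ‖(b : 𝕜) • S (U c) - (a : 𝕜) • T (V c)‖]
  -- A factor t in place of 2s would yield the bound (2t - t²/(2s))‖z‖², which is largest at t = 2s.
  have hexpand {R : E →ₗ[𝕜] E} (hR : R.IsSymmetric) (x z : E) :
      RCLike.re (inner 𝕜 (R (((2 * s : ℝ) : 𝕜) • x - z)) (((2 * s : ℝ) : 𝕜) • x - z)) =
        4 * s ^ 2 * RCLike.re (inner 𝕜 (R x) x) - 4 * s * RCLike.re (inner 𝕜 (R x) z) +
          RCLike.re (inner 𝕜 (R z) z) := by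
    have hsymm : RCLike.re (inner 𝕜 (R z) x) = RCLike.re (inner 𝕜 (R x) z) := by
      rw [hR z x, inner_re_symm]
    simp only [map_sub, map_smul, inner_sub_left, inner_sub_right, inner_smul_left,
      inner_smul_right, RCLike.conj_ofReal, RCLike.re_ofReal_mul, hsymm]
    ring
  -- `Z` is injective because `hZge` bounds its norm below by a positive multiple of |c|.
  refine hP.le_eigenvalues_of_lt_finrank hn j Z (by simp) (fun c hc h ↦ ?_) fun c ↦ ?_
  · have hcpos : 0 < ∑ i, ‖c i‖ ^ 2 := by
      obtain ⟨i, hi⟩ := Function.ne_iff.1 hc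
      exact Finset.sum_pos' (fun _ _ ↦ sq_nonneg _)
        ⟨i, Finset.mem_univ i, pow_pos (norm_pos_iff.2 hi) 2⟩
    have := hZge c
    rw [h, norm_zero] at this
    have hpos : 0 < 4 * a * b * s * ∑ i, ‖c i‖ ^ 2 := by positivity
    linarith
  · have hcross : b * RCLike.re (inner 𝕜 (S (U c)) (Z c)) +
        a * RCLike.re (inner 𝕜 (T (V c)) (Z c)) = ‖Z c‖ ^ 2 := by
      rw [← inner_self_eq_norm_sq (𝕜 := 𝕜), ← RCLike.re_ofReal_mul, ← RCLike.re_ofReal_mul,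
        ← map_add]
      nth_rewrite 3 [hZ]
      rw [inner_add_left, inner_smul_left, inner_smul_left, RCLike.conj_ofReal,
        RCLike.conj_ofReal]
    have h1 := mul_nonneg hb.le (hS.2 (((2 * s : ℝ) : 𝕜) • U c - Z c))
    have h2 := mul_nonneg ha.le (hT.2 (((2 * s : ℝ) : 𝕜) • V c - Z c))
    rw [hexpand hS.1] at h1
    rw [hexpand hT.1] at h2
    have h3 := mul_le_mul_of_nonneg_left (hSa (U c)) (by positivity : 0 ≤ 4 * s ^ 2 * b)
    have h4 := mul_le_mul_of_nonneg_left (hTb (V c)) (by positivity : 0 ≤ 4 * s ^ 2 * a)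
    have h5 := mul_le_mul_of_nonneg_left (hZge c) (by positivity : 0 ≤ 2 * s)
    rw [hU] at h3
    rw [hV] at h4
    rw [hPre]
    linear_combination h1 + h2 + h3 + h4 + h5 - 4 * s * hcross

theorem Matrix.re_inner_toEuclideanLin_self_le {m : Type*} [Fintype m] [DecidableEq m]
    (A : Matrix m m ℂ) (x : EuclideanSpace ℂ m) :
    RCLike.re (inner ℂ (Matrix.toEuclideanLin A x) x) ≤ ‖A‖ * ‖x‖ ^ 2 := by
  refine (re_inner_le_norm _ _).trans ?_
  rw [pow_two, ← mul_assoc]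
  exact mul_le_mul_of_nonneg_right (A.l2_opNorm_mulVec x) (norm_nonneg x)

/-- Here `‖·‖` is the spectral norm (the `ℓ²` operator norm). -/
theorem proposition4p2 {n : ℕ} (A B : Matrix (Fin n) (Fin n) ℂ)
    (hA : A.PosSemidef) (hB : B.PosSemidef) (j : Fin n) :
    2 * (A * B).sv j ≤
      (‖B‖ • A + ‖A‖ • B).eig (hA.isHermitian_smul_add_smul hB ‖B‖ ‖A‖) j := by
  have hmul : Matrix.toEuclideanLin (A * B) =
      Matrix.toEuclideanLin A ∘ₗ Matrix.toEuclideanLin B := Matrix.toLpLin_mul_same ..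
  rw [Matrix.sv, hmul]
  rcases (LinearMap.singularValues_nonneg
    (Matrix.toEuclideanLin A ∘ₗ Matrix.toEuclideanLin B) j).eq_or_lt with h0 | hs
  -- If s = 0, only nonnegativity of the eigenvalues is needed; otherwise AB ≠ 0, so both norms are
  -- positive.
  · rw [← h0, mul_zero]
    have hP := (hA.smul (norm_nonneg B)).add (hB.smul (norm_nonneg A))
    exact (Matrix.isPositive_toEuclideanLin_iff.2 hP).nonneg_eigenvalues _ _
  have hA0 : A ≠ 0 := by
    rintro rfl
    simp at hs
  have hB0 : B ≠ 0 := by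
    rintro rfl
    simp at hs
  refine (Matrix.isPositive_toEuclideanLin_iff.2 hA).two_mul_singularValues_comp_le
    (Matrix.isPositive_toEuclideanLin_iff.2 hB) _ (norm_pos_iff.2 hA0) (norm_pos_iff.2 hB0)
    A.re_inner_toEuclideanLin_self_le B.re_inner_toEuclideanLin_self_le (fun x ↦ ?_) _
    (Fin.cast (Fintype.card_fin n).symm j) hs
  rw [map_add, LinearMap.add_apply, RCLike.real_smul_eq_coe_smul (K := ℂ),
    RCLike.real_smul_eq_coe_smul (K := ℂ), map_smul, map_smul]
  rfl
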